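/- Let $n\ge 2$, let $\mathbb F_q$ be a finite field with $q$ elements, let $\mu$ be a generator of $\mathbb F_q^*$, and let $V=\mathbb F_q^{n+1}$ with standard basis $v_0,\dots,v_n$. Let $Z$ be the group of invertible scalar transformations of $V$, and let $G$ be a group with $Z\,\mathrm{SL}_{n+1}(q)\le G\le \Gamma\mathrm L_{n+1}(q)$, where $\Gamma\mathrm L_{n+1}(q)$ is the group of all semilinear bijections of $V$. Write $\alpha_0=\langle v_0\rangle$ and let $G(\alpha_0)$ be the stabilizer in $G$ of the line $\alpha_0$. Let $W$ be the subgroup of $G$ fixing pointwise both $V/\alpha_0$ and $\alpha_0$. Regard $\mathrm{SL}_n(q)$ as the group of linear automorphisms of $V$ of determinant $1$ that fix $v_0$ and preserve $\langle v_1,\dots,v_n\rangle$, and set $M=W\rtimes Z\,\mathrm{SL}_n(q)$. For $H\le\Gamma\mathrm L_{n+1}(q)$ write $H_{\mathrm{GL}}=H\cap\mathrm{GL}_{n+1}(q)$ and $e_H=|H:H_{\mathrm{GL}}|$, write $\det(H_{\mathrm{GL}})\le\mathbb F_q^*$ for the group of determinants of elements of $H_{\mathrm{GL}}$, and write $\mathrm{Pdet}(H_{\mathrm{GL}})$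 for the image of $\det(H_{\mathrm{GL}})$ in $\mathbb F_q^*/\langle\mu^{n+1}\rangle$. An action of a group $A$ on a set $\Omega$ with an equivalence relation $\sim$, whose classes are called blocks, is $2$-by-block-transitive if $\sim$ is $A$-invariant, there are at least two blocks, and $A$ is transitive on the ordered pairs of points lying in different blocks. Let $L$ be a subgroup with $M\le L\le G(\alpha_0)$. Then the following are equivalent: (i) there is an equivalence relation on $G/L$ for which the action of $G$ on $G/L$ is $2$-by-block-transitive and the setwise stabilizer of the block containing the trivial coset $L$ is $G(\alpha_0)$; (ii) $e_L=e_G$ and $\det(L_{\mathrm{GL}})=\det(G_{\mathrm{GL}})$; (iii) $e_L=e_G$ and the index $|G(\alpha_0):L|$ is coprime to $|\mathrm{Pdet}(G_{\mathrm{GL}})|$. -/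

import Mathlib

/-! Actions transitive on distant tuples -/

namespace BlockAction

variable {Ω : Type*}

/-- A `k`-tuple of points is distant (for the equivalence relation `r`) if no two of its entries
lie in the same block, that is, in the same `r`-class. -/
def IsDistant (r : Setoid Ω) {k : ℕ} (x : Fin k → Ω) : Prop :=
  ∀ i j : Fin k, i ≠ j → ¬ r (x i) (x j)

/-- The action of `G` on `Ω` is `k`-by-block-transitive with respect to `r`: the relation is
`G`-invariant, there are at least `k` blocks, and `G` is transitive on distant `k`-tuples. -/
structure IsByBlockTransitive (G : Type*) [Group G] [MulAction G Ω] (k : ℕ) (r : Setoid Ω) :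
    Prop where
  invariant : ∀ (g : G) (x y : Ω), r x y → r (g • x) (g • y)
  blocks : Nonempty (Fin k ↪ Quotient r)
  transitive : ∀ x y : Fin k → Ω, IsDistant r x → IsDistant r y → ∃ g : G, ∀ i, g • x i = y i

open scoped Pointwise in
/-- The setwise stabilizer in `G` of the block containing `ω`. -/
def blockStabilizer (G : Type*) [Group G] [MulAction G Ω] (r : Setoid Ω) (ω : Ω) : Subgroup G :=
  MulAction.stabilizer G {x : Ω | r x ω}

/-- For `L ≤ H ≤ G`: the action of `G` on the coset space `G / L` is `2`-by-block-transitive for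
some equivalence relation such that the block containing the coset `L` has stabilizer `H`. -/
def HasTwoByBlockTransitiveCosetAction {A : Type*} [Group A] (G L H : Subgroup A) : Prop :=
  ∃ r : Setoid (G ⧸ L.subgroupOf G),
    IsByBlockTransitive G 2 r ∧
      blockStabilizer G r (QuotientGroup.mk (1 : G) : G ⧸ L.subgroupOf G) = H.subgroupOf G

end BlockAction

/-! Semilinear groups on `V = K ^ (n + 1)` with standard basis `v 0, …, v n`.
All groups are subgroups of the group of permutations of `V`. -/

namespace SemilinearGroup

variable (n : ℕ) (K : Type*) [Field K]

theorem apply_inv_apply {X : Type*} (g : Equiv.Perm X) (x : X) : g (g⁻¹ x) = x :=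
  g.apply_symm_apply x

/-- The space `V = K ^ (n + 1)`. -/
abbrev V : Type _ := Fin (n + 1) → K

/-- The semilinear group `ΓL (n + 1, K)`. -/
def GammaL : Subgroup (Equiv.Perm (V n K)) where
  carrier := {g | (∀ u v : V n K, g (u + v) = g u + g v) ∧
    ∃ σ : K ≃+* K, ∀ (a : K) (v : V n K), g (a • v) = σ a • g v}
  one_mem' := ⟨fun _ _ => rfl, RingEquiv.refl K, fun _ _ => rfl⟩
  mul_mem' := by
    rintro g h ⟨hg, σ, hσ⟩ ⟨hh, τ, hτ⟩
    refine ⟨fun u v => ?_, τ.trans σ, fun a v => ?_⟩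
    · simp only [Equiv.Perm.mul_apply, hh, hg]
    · rw [Equiv.Perm.mul_apply, Equiv.Perm.mul_apply, hτ, hσ]
      rfl
  inv_mem' := by
    rintro g ⟨hg, σ, hσ⟩
    refine ⟨fun u v => g.injective ?_, σ.symm, fun a v => g.injective ?_⟩
    · rw [hg, apply_inv_apply, apply_inv_apply, apply_inv_apply]
    · rw [hσ, apply_inv_apply, apply_inv_apply, RingEquiv.apply_symm_apply]

/-- The inclusion of the linear automorphisms of `V` into the permutations of `V`. -/
def linIncl : (V n K ≃ₗ[K] V n K) →* Equiv.Perm (V n K) where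
  toFun f := f.toEquiv
  map_one' := rfl
  map_mul' _ _ := rfl

/-- The general linear group `GL (n + 1, K)`. -/
def GenLin : Subgroup (Equiv.Perm (V n K)) := (linIncl n K).range

/-- The special linear group `SL (n + 1, K)`. -/
noncomputable def SpecLin : Subgroup (Equiv.Perm (V n K)) :=
  (LinearEquiv.det : (V n K ≃ₗ[K] V n K) →* Kˣ).ker.map (linIncl n K)

/-- The group `Z` of (invertible) scalar transformations. -/
def Z : Subgroup (Equiv.Perm (V n K)) where
  carrier := {g | ∃ a : Kˣ, ∀ v : V n K, g v = a • v}
  one_mem' := ⟨1, fun v => (one_smul Kˣ v).symm⟩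
  mul_mem' := by
    rintro g h ⟨a, ha⟩ ⟨b, hb⟩
    refine ⟨a * b, fun v => ?_⟩
    rw [Equiv.Perm.mul_apply, hb, ha, mul_smul]
  inv_mem' := by
    rintro g ⟨a, ha⟩
    refine ⟨a⁻¹, fun v => g.injective ?_⟩
    rw [apply_inv_apply, ha, smul_inv_smul]

/-- The standard basis vector `v i`. -/
def v (i : Fin (n + 1)) : V n K := Pi.single i 1

/-- The line `α₀` spanned by `v 0`. -/
def alpha0 : Submodule K (V n K) := Submodule.span K {v n K 0}

/-- The hyperplane spanned by `v 1, …, v n`. -/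
def hyperplane : Submodule K (V n K) :=
  Submodule.span K (Set.range fun i : Fin n => v n K i.succ)

variable {n K}

open scoped Pointwise in
/-- The stabilizer `H(U)` in `H` of a subspace `U`. -/
def stab (H : Subgroup (Equiv.Perm (V n K))) (U : Submodule K (V n K)) : Subgroup (Equiv.Perm (V n K)) :=
  H ⊓ MulAction.stabilizer (Equiv.Perm (V n K)) (U : Set (V n K))

/-- The subgroup of `H` fixing pointwise the subspace `U`. -/
def fix (H : Subgroup (Equiv.Perm (V n K))) (U : Submodule K (V n K)) : Subgroup (Equiv.Perm (V n K)) :=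
  H ⊓ fixingSubgroup (Equiv.Perm (V n K)) (U : Set (V n K))

/-- The subgroup of `H` fixing pointwise the quotient space `V / U`. -/
def fixQuot (H : Subgroup (Equiv.Perm (V n K))) (U : Submodule K (V n K)) :
    Subgroup (Equiv.Perm (V n K)) where
  carrier := {g | g ∈ H ∧ ∀ x : V n K, g x - x ∈ U}
  one_mem' := ⟨H.one_mem, fun x => by simp⟩
  mul_mem' := by
    rintro g h ⟨hg, hg'⟩ ⟨hh, hh'⟩
    refine ⟨H.mul_mem hg hh, fun x => ?_⟩
    have := U.add_mem (hg' (h x)) (hh' x)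
    rwa [sub_add_sub_cancel] at this
  inv_mem' := by
    rintro g ⟨hg, hg'⟩
    refine ⟨H.inv_mem hg, fun x => ?_⟩
    have := U.neg_mem (hg' (g⁻¹ x))
    rwa [apply_inv_apply, neg_sub] at this

/-- The linear part `H ∩ GL (n + 1, K)` of `H`. -/
def linPart (H : Subgroup (Equiv.Perm (V n K))) : Subgroup (Equiv.Perm (V n K)) := H ⊓ GenLin n K

/-- The index `e_H` of the linear part of `H` in `H`. -/
noncomputable def e (H : Subgroup (Equiv.Perm (V n K))) : ℕ := (linPart H).relIndex H

/-- The group of determinants of the linear elements of `H`. -/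
noncomputable def detLin (H : Subgroup (Equiv.Perm (V n K))) : Subgroup Kˣ :=
  (H.comap (linIncl n K)).map LinearEquiv.det

/-- The group of projective determinants of the linear elements of `H`, as a subgroup of
`Kˣ / ⟨μ ^ (n + 1)⟩`, for `μ` a generator of `Kˣ`. -/
noncomputable def PdetLin (μ : Kˣ) (H : Subgroup (Equiv.Perm (V n K))) :
    Subgroup (Kˣ ⧸ Subgroup.zpowers (μ ^ (n + 1))) :=
  (detLin H).map (QuotientGroup.mk' (Subgroup.zpowers (μ ^ (n + 1))))

/-- The subgroup `W` of `G` fixing pointwise `V / α₀` and `α₀`. -/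
def W (G : Subgroup (Equiv.Perm (V n K))) : Subgroup (Equiv.Perm (V n K)) :=
  fixQuot G (alpha0 n K) ⊓ fix G (alpha0 n K)

variable (n K) in
/-- The copy of `GL (n, K)` in `GL (n + 1, K)` acting on the span of `v 1, …, v n` and
fixing `v 0`. -/
def GLsmall : Subgroup (Equiv.Perm (V n K)) :=
  fix (GenLin n K) (alpha0 n K) ⊓ stab (GenLin n K) (hyperplane n K)

variable (n K) in
/-- The copy of `SL (n, K)`: the elements of the copy of `GL (n, K)` of determinant `1`. (An
element fixing `v 0` and preserving the span of `v 1, …, v n` has the same determinant on this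
span as on `V`.) -/
noncomputable def SLsmall : Subgroup (Equiv.Perm (V n K)) := GLsmall n K ⊓ SpecLin n K

/-- The group `M = W ⋊ (Z · SL (n, K))`, an internal product of subgroups of `G`. -/
noncomputable def M (G : Subgroup (Equiv.Perm (V n K))) : Subgroup (Equiv.Perm (V n K)) :=
  W G ⊔ (Z n K ⊔ SLsmall n K)

end SemilinearGroup

/-! Write `H = G(α₀)`, and let `S = SL (n + 1, K)`. Condition (i) says exactly that `H < G` and that
`G \ H` is one double coset of `L`. Since `M` contains the stabilizer of `v 0` in `S`
(`linIncl_mem_M`), so does `L`.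

Both (i) and (ii) amount to `G = L S`. If `G \ H = L t L` with `t` a transvection, then `a t b = (a
b)(b⁻¹ t b)` lies in `L S`, as semilinear conjugates of transvections are transvections; multiplying
by `t` handles the elements of `H`. Conversely, since `n + 1 ≥ 3`, the stabilizer of `v 0` in `S` is
transitive on the vectors outside `α₀`, which merges all of `L S \ H` into one double coset. That
(ii) means `G = L S` holds because `S` is the kernel of the determinant on the linear part.

For (ii) and (iii), let `D = det (G_GL)`, let `T` be the group of determinants of the linear
elements of `L` fixing `v 0`, and let `C = ⟨μ ^ (n + 1)⟩` be that of the scalars. Then `det (L_GL) =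
T C`, `|Pdet (G_GL)| = |D : C|`, and `|H : L| = |D : T|` once `e_L = e_G`. In the cyclic group `D`,
`T C = D` exactly when the two indices are coprime. -/

/-! Double cosets and two-by-block-transitive coset actions -/

namespace BlockAction

variable {A : Type*} [Group A] {G L H : Subgroup A}

open scoped Pointwise in
/-- The coset action of `G` on `G / L` is `2`-by-block-transitive with block stabilizer `H` if and
only if `H` is proper in `G` and `G \ H` is a single double coset of `L`. -/
theorem hasTwoByBlockTransitiveCosetAction_iff (hLH : L ≤ H) (hHG : H ≤ G) :
    HasTwoByBlockTransitiveCosetAction G L H ↔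
      (∃ x ∈ G, x ∉ H) ∧
        ∀ x ∈ G, x ∉ H → ∀ y ∈ G, y ∉ H → ∃ a ∈ L, ∃ b ∈ L, y = a * x * b := by
  constructor
  · rintro ⟨r, hr, hs⟩
    set o : G ⧸ L.subgroupOf G := QuotientGroup.mk 1 with ho
    have key : ∀ x : G, r (x • o) o ↔ (x : A) ∈ H := by
      intro x
      rw [← Subgroup.mem_subgroupOf, ← hs, blockStabilizer, MulAction.mem_stabilizer_iff]
      constructor
      · intro h
        ext z
        rw [Set.mem_smul_set_iff_inv_smul_mem, Set.mem_ofPred_eq, Set.mem_ofPred_eq]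
        constructor
        · intro hz
          have := hr.invariant x _ _ hz
          rw [smul_inv_smul] at this
          exact r.trans this h
        · intro hz
          have := hr.invariant x⁻¹ _ _ (r.trans hz (r.symm h))
          rwa [inv_smul_smul] at this
      · intro h
        have : x • o ∈ x • {z | r z o} := Set.smul_mem_smul_set (r.refl o)
        rwa [h] at this
    have hdist : ∀ x : G, (x : A) ∉ H → IsDistant r ![o, x • o] := by
      intro x hx i j hij
      fin_cases i <;> fin_cases j <;> simp at hij ⊢
      · exact fun h => hx ((key x).1 (r.symm h))
      · exact fun h => hx ((key x).1 h)
    constructor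
    · obtain ⟨f⟩ := hr.blocks
      obtain ⟨x, hx⟩ := Quotient.exists_rep (f 0)
      obtain ⟨y, hy⟩ := Quotient.exists_rep (f 1)
      obtain ⟨x, rfl⟩ := QuotientGroup.mk_surjective x
      obtain ⟨y, rfl⟩ := QuotientGroup.mk_surjective y
      have hx' : (QuotientGroup.mk x : G ⧸ L.subgroupOf G) = x • o := by
        rw [ho, MulAction.Quotient.smul_mk, smul_eq_mul, mul_one]
      have hy' : (QuotientGroup.mk y : G ⧸ L.subgroupOf G) = y • o := by
        rw [ho, MulAction.Quotient.smul_mk, smul_eq_mul, mul_one]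
      by_contra! hcon
      have h1 := (key x).2 (hcon x x.2)
      have h2 := (key y).2 (hcon y y.2)
      have : f 0 = f 1 := by
        rw [← hx, ← hy, hx', hy']
        exact Quotient.sound (r.trans h1 (r.symm h2))
      simpa using f.injective this
    · intro x hx hxH y hy hyH
      obtain ⟨g, hg⟩ := hr.transitive _ _ (hdist ⟨x, hx⟩ hxH) (hdist ⟨y, hy⟩ hyH)
      have h0 := hg 0
      have h1 := hg 1
      simp only [Matrix.cons_val_zero, Matrix.cons_val_one, ho,
        MulAction.Quotient.smul_mk, smul_eq_mul, mul_one, QuotientGroup.eq,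
        Subgroup.mem_subgroupOf, Subgroup.coe_mul, Subgroup.coe_inv] at h0 h1
      exact ⟨g, by simpa using h0, _, h1, by group⟩
  · rintro ⟨⟨x₀, hx₀, hx₀H⟩, htr⟩
    -- The blocks are the fibres of `G / L → G / H`.
    have hle : L.subgroupOf G ≤ H.subgroupOf G := fun x hx => hLH hx
    have hmk : ∀ x y : G, Setoid.ker (Subgroup.quotientMapOfLE hle) (QuotientGroup.mk x)
        (QuotientGroup.mk y) ↔ (x : A)⁻¹ * y ∈ H := by
      intro x y
      rw [Setoid.ker_def, Subgroup.quotientMapOfLE_apply_mk, Subgroup.quotientMapOfLE_apply_mk,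
        QuotientGroup.eq, Subgroup.mem_subgroupOf]
      rfl
    have hinv : ∀ (g : G) (x y : G ⧸ L.subgroupOf G), Setoid.ker (Subgroup.quotientMapOfLE hle) x y →
        Setoid.ker (Subgroup.quotientMapOfLE hle) (g • x) (g • y) := by
      intro g x y
      obtain ⟨x, rfl⟩ := QuotientGroup.mk_surjective x
      obtain ⟨y, rfl⟩ := QuotientGroup.mk_surjective y
      rw [MulAction.Quotient.smul_mk, MulAction.Quotient.smul_mk, hmk, hmk]
      simp [mul_assoc]
    refine ⟨Setoid.ker (Subgroup.quotientMapOfLE hle), ⟨hinv, ?_, ?_⟩, ?_⟩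
    · refine ⟨⟨![Quotient.mk _ (QuotientGroup.mk 1), Quotient.mk _ (QuotientGroup.mk ⟨x₀, hx₀⟩)],
        ?_⟩⟩
      have : ¬ (Setoid.ker (Subgroup.quotientMapOfLE hle)) (QuotientGroup.mk 1)
          (QuotientGroup.mk ⟨x₀, hx₀⟩) := by
        rw [hmk]; simpa using hx₀H
      intro i j hij
      fin_cases i <;> fin_cases j
      · rfl
      · exact (this (Quotient.exact hij)).elim
      · exact (this (Quotient.exact hij.symm)).elim
      · rfl
    · intro x y hx hy
      have hx := hx 0 1 (by simp)
      have hy := hy 0 1 (by simp)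
      obtain ⟨a, ha⟩ := QuotientGroup.mk_surjective (x 0)
      obtain ⟨b, hb⟩ := QuotientGroup.mk_surjective (x 1)
      obtain ⟨c, hc⟩ := QuotientGroup.mk_surjective (y 0)
      obtain ⟨d, hd⟩ := QuotientGroup.mk_surjective (y 1)
      rw [← ha, ← hb, hmk] at hx
      rw [← hc, ← hd, hmk] at hy
      obtain ⟨l, hl, l', hl', h⟩ := htr _ (a⁻¹ * b).2 hx _ (c⁻¹ * d).2 hy
      -- It sends `aL` to `cL` because `l ∈ L`, and `bL` to `dL` because `c⁻¹ d = l (a⁻¹ b) l'`.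
      refine ⟨c * ⟨l, hHG (hLH hl)⟩ * a⁻¹, ?_⟩
      rw [Fin.forall_fin_two, ← ha, ← hb, ← hc, ← hd, MulAction.Quotient.smul_mk,
        MulAction.Quotient.smul_mk, QuotientGroup.eq, QuotientGroup.eq, Subgroup.mem_subgroupOf,
        Subgroup.mem_subgroupOf]
      constructor
      · simpa using hl
      · have hd' : (d : A) = c * l * (a : A)⁻¹ * b * l' := by
          have : (d : A) = c * ((c : A)⁻¹ * d) := by group
          rw [this]
          simp only [Subgroup.coe_mul, Subgroup.coe_inv] at h
          rw [h]
          group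
        have : (((c * ⟨l, hHG (hLH hl)⟩ * a⁻¹) • b : G) : A)⁻¹ * (d : A) = l' := by
          rw [hd']
          simp only [smul_eq_mul, Subgroup.coe_mul, Subgroup.coe_inv]
          group
        rw [Subgroup.coe_mul, Subgroup.coe_inv, this]
        exact hl'
    · ext g
      rw [blockStabilizer, MulAction.mem_stabilizer_iff, Subgroup.mem_subgroupOf]
      have hg : Setoid.ker (Subgroup.quotientMapOfLE hle) (g • QuotientGroup.mk 1)
          (QuotientGroup.mk 1) ↔ (g : A) ∈ H := by
        rw [MulAction.Quotient.smul_mk, hmk]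
        simp
      constructor
      · intro h
        rw [← hg]
        have : g • (QuotientGroup.mk 1 : G ⧸ L.subgroupOf G) ∈
            g • {z | Setoid.ker (Subgroup.quotientMapOfLE hle) z (QuotientGroup.mk 1)} :=
          Set.smul_mem_smul_set ((Setoid.ker (Subgroup.quotientMapOfLE hle)).refl _)
        rwa [h] at this
      · intro h
        ext z
        rw [Set.mem_smul_set_iff_inv_smul_mem, Set.mem_ofPred_eq, Set.mem_ofPred_eq]
        constructor
        · intro hz
          have := hinv g _ _ hz
          rw [smul_inv_smul] at this
          exact Setoid.trans' _ this (hg.2 h)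
        · intro hz
          have := hinv g⁻¹ _ _ (Setoid.trans' _ hz (Setoid.symm' _ (hg.2 h)))
          rwa [inv_smul_smul] at this

end BlockAction

/-! Indices of subgroups -/

namespace Subgroup

/-- For `B ≤ C` finite, `N` has the same relative index in `B` and `C` if and only if every left
coset of `N` meeting `C` meets `B`. -/
theorem relIndex_eq_relIndex_iff {A : Type*} [Group A] [Finite A] (N : Subgroup A)
    {B C : Subgroup A} (hBC : B ≤ C) :
    N.relIndex B = N.relIndex C ↔ ∀ c ∈ C, ∃ b ∈ B, b⁻¹ * c ∈ N := by
  have hinj := (quotientSubgroupOfEmbeddingOfLE N hBC).injective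
  have hsurj : Function.Surjective (quotientSubgroupOfEmbeddingOfLE N hBC) ↔
      ∀ c ∈ C, ∃ b ∈ B, b⁻¹ * c ∈ N := by
    constructor
    · intro h c hc
      obtain ⟨q, hq⟩ := h (QuotientGroup.mk ⟨c, hc⟩)
      obtain ⟨b, rfl⟩ := QuotientGroup.mk_surjective q
      rw [quotientSubgroupOfEmbeddingOfLE_apply_mk, QuotientGroup.eq, mem_subgroupOf] at hq
      exact ⟨b, b.2, hq⟩
    · intro h q
      obtain ⟨c, rfl⟩ := QuotientGroup.mk_surjective q
      obtain ⟨b, hb, hbc⟩ := h c c.2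
      refine ⟨QuotientGroup.mk ⟨b, hb⟩, ?_⟩
      rw [quotientSubgroupOfEmbeddingOfLE_apply_mk, QuotientGroup.eq, mem_subgroupOf]
      exact hbc
  rw [← hsurj]
  constructor
  · intro h
    exact (hinj.bijective_of_nat_card_le (Nat.card_congr (Equiv.refl _) ▸ h.ge)).2
  · intro h
    exact Nat.card_congr (Equiv.ofBijective _ ⟨hinj, h⟩)

/-- The quotient `D / T` is cyclic, generated by the image of `g`, so the index is the order of that
image. -/
theorem dvd_of_dvd_relIndex_of_zpow_mem {A : Type*} [CommGroup A] {T D : Subgroup A}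
    {g : A} (hg : zpowers g = D) {p : ℕ} (hp : p ∣ T.relIndex D) {j : ℤ} (hj : g ^ j ∈ T) :
    (p : ℤ) ∣ j := by
  subst hg
  set x : zpowers g ⧸ T.subgroupOf (zpowers g) := QuotientGroup.mk ⟨g, mem_zpowers g⟩
  have hx : orderOf x = T.relIndex (zpowers g) := by
    refine orderOf_eq_card_of_forall_mem_zpowers fun y => ?_
    obtain ⟨⟨y, k, rfl⟩, rfl⟩ := QuotientGroup.mk_surjective y
    exact ⟨k, by simp only [x, ← QuotientGroup.mk_zpow]; rfl⟩
  rw [← hx] at hp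
  refine (Int.natCast_dvd_natCast.2 hp).trans (orderOf_dvd_iff_zpow_eq_one.2 ?_)
  rw [← QuotientGroup.mk_zpow, QuotientGroup.eq_one_iff, mem_subgroupOf]
  simpa using hj

/-- Two subgroups of a cyclic group generate it if and only if their indices are coprime. -/
theorem sup_eq_iff_coprime_relIndex {A : Type*} [CommGroup A] {T C D : Subgroup A} [IsCyclic D]
    (hT : T ≤ D) (hC : C ≤ D) :
    T ⊔ C = D ↔ Nat.Coprime (T.relIndex D) (C.relIndex D) := by
  constructor
  · intro h
    obtain ⟨g, hg⟩ := Subgroup.isCyclic_iff_exists_zpowers_eq_top D |>.1 inferInstance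
    refine Nat.Coprime.symm (Nat.coprime_of_dvd fun p hp h1 h2 => ?_)
    have hgm : g ∈ T ⊔ C := by rw [h, ← hg]; exact mem_zpowers g
    obtain ⟨t, ht, c, hc, htc⟩ := mem_sup.1 hgm
    obtain ⟨j, rfl⟩ : t ∈ zpowers g := hg ▸ hT ht
    obtain ⟨k, rfl⟩ : c ∈ zpowers g := hg ▸ hC hc
    have hj := dvd_of_dvd_relIndex_of_zpow_mem hg h2 ht
    have hk := dvd_of_dvd_relIndex_of_zpow_mem hg h1 hc
    -- This power is trivial, so a common prime `p` of the indices divides `j`, `k` and `j + k - 1`,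
    -- hence `1`.
    have h3 : g ^ (j + k - 1) ∈ T := by
      have h4 : g ^ j * g ^ k = g := htc
      rw [zpow_sub_one, zpow_add, h4, mul_inv_cancel]
      exact T.one_mem
    have := dvd_of_dvd_relIndex_of_zpow_mem hg h2 h3
    have h5 : (p : ℤ) ∣ 1 := by
      have := dvd_sub (dvd_add hj hk) this
      simpa using this
    exact hp.one_lt.ne' (by exact_mod_cast Int.eq_one_of_dvd_one (by positivity) h5)
  · intro h
    refine le_antisymm (sup_le hT hC) (relIndex_eq_one.1 ?_)
    exact Nat.eq_one_of_dvd_coprimes h (relIndex_dvd_of_le_left _ le_sup_left)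
      (relIndex_dvd_of_le_left _ le_sup_right)

end Subgroup

/-! Transvections -/

namespace LinearEquiv

variable {K E : Type*} [Field K] [AddCommGroup E] [Module K E]

/-- Each span is a proper subspace, and two proper subspaces never cover a vector space. -/
theorem exists_notMem_span_pair (hE : 2 < Module.finrank K E) (a b c d : E) :
    ∃ u, u ∉ Submodule.span K {a, b} ∧ u ∉ Submodule.span K {c, d} := by
  have h : ∀ a b : E, ∃ u, u ∉ Submodule.span K {a, b} := by
    intro a b
    by_contra! h
    classical
    have h1 : Module.finrank K (Submodule.span K ((({a, b} : Finset E)) : Set E)) ≤ 2 :=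
      (finrank_span_finset_le_card _).trans Finset.card_le_two
    have h2 : Submodule.span K ({a, b} : Set E) = ⊤ := Submodule.eq_top_iff'.2 h
    rw [Finset.coe_pair, h2, finrank_top] at h1
    omega
  obtain ⟨x, hx⟩ := h a b
  obtain ⟨y, hy⟩ := h c d
  by_cases hx' : x ∈ Submodule.span K {c, d}
  · by_cases hy' : y ∈ Submodule.span K {a, b}
    · exact ⟨x + y, fun h => hx ((Submodule.add_mem_iff_left _ hy').1 h),
        fun h => hy ((Submodule.add_mem_iff_right _ hx').1 h)⟩
    · exact ⟨y, hy', hy⟩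
  · exact ⟨x, hx, hx'⟩

/-- A transvection in the direction `u - w` works, given a functional that kills `p` and `u - w` but
not `w`; scaling makes its value at `w` equal to `1`. -/
theorem exists_det_eq_one_of_notMem_span_pair {p w u : E} (hw : w ∉ Submodule.span K {p})
    (hu : u ∉ Submodule.span K {p, w}) :
    ∃ m : E ≃ₗ[K] E, LinearEquiv.det m = 1 ∧ m p = p ∧ m w = u := by
  have h : w ∉ Submodule.span K {p, u - w} := by
    intro h
    obtain ⟨a, b, hab⟩ := Submodule.mem_span_pair.1 h
    by_cases hb : b = 0
    · subst hb
      exact hw (Submodule.mem_span_singleton.2 ⟨a, by simpa using hab⟩)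
    · refine hu (Submodule.mem_span_pair.2 ⟨-(b⁻¹ * a), b⁻¹ * (1 + b), ?_⟩)
      have h1 : b • u = (1 + b) • w - a • p := by
        have h2 : b • u = (a • p + b • (u - w)) + b • w - a • p := by rw [smul_sub]; abel
        rw [h2, hab, add_smul, one_smul]
      rw [← inv_smul_smul₀ hb u, h1, smul_sub, smul_smul, smul_smul, neg_smul]
      abel
  obtain ⟨f, hf, hf'⟩ := Submodule.exists_le_ker_of_notMem h
  have hp : f p = 0 := hf' (Submodule.subset_span (by simp))
  have huw : f (u - w) = 0 := hf' (Submodule.subset_span (by simp))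
  have h0 : ((f w)⁻¹ • f) (u - w) = 0 := by simp [huw]
  refine ⟨LinearEquiv.transvection h0, LinearEquiv.transvection.det_eq_one h0, ?_, ?_⟩
  · rw [LinearEquiv.transvection.apply]; simp [hp]
  · rw [LinearEquiv.transvection.apply]; simp [hf]

/-- In dimension at least `3` the stabilizer of a vector `p` in the special linear group is
transitive on the vectors outside the span of `p`. -/
theorem exists_det_eq_one_of_notMem_span (hE : 2 < Module.finrank K E) {p w w' : E}
    (hw : w ∉ Submodule.span K {p}) (hw' : w' ∉ Submodule.span K {p}) :
    ∃ m : E ≃ₗ[K] E, LinearEquiv.det m = 1 ∧ m p = p ∧ m w' = w := by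
  -- A single transvection may fail when `w'` lies in the plane of `p` and `w`, so the move passes
  -- through `u` outside both planes.
  obtain ⟨u, hu, hu'⟩ := exists_notMem_span_pair hE p w p w'
  obtain ⟨m, hm, hmp, hmw⟩ := exists_det_eq_one_of_notMem_span_pair hw hu
  obtain ⟨m', hm', hmp', hmw'⟩ := exists_det_eq_one_of_notMem_span_pair hw' hu'
  refine ⟨m⁻¹ * m', by simp [hm, hm'], ?_, ?_⟩
  · change m.symm (m' p) = p
    rw [hmp', LinearEquiv.symm_apply_eq, hmp]
  · change m.symm (m' w') = w
    rw [hmw', LinearEquiv.symm_apply_eq, hmw]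

theorem exists_det_eq_one_of_ne_zero (hE : 2 < Module.finrank K E) {w w' : E}
    (hw : w ≠ 0) (hw' : w' ≠ 0) :
    ∃ m : E ≃ₗ[K] E, LinearEquiv.det m = 1 ∧ m w' = w := by
  obtain ⟨p, hp, -⟩ := exists_notMem_span_pair hE w w' w w'
  have h : ∀ z : E, z ≠ 0 → z ∈ Submodule.span K {w, w'} → z ∉ Submodule.span K {p} := by
    intro z hz hzm h
    obtain ⟨a, rfl⟩ := Submodule.mem_span_singleton.1 h
    have ha : a ≠ 0 := fun h => hz (by simp [h])
    exact hp ((Submodule.smul_mem_iff _ ha).1 hzm)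
  obtain ⟨m, hm, -, hmw⟩ := exists_det_eq_one_of_notMem_span hE
    (h w hw (Submodule.subset_span (by simp))) (h w' hw' (Submodule.subset_span (by simp)))
  exact ⟨m, hm, hmw⟩

end LinearEquiv

/-! ### Semilinear maps, the group `M` and the stabilizer of `α₀` -/

namespace SemilinearGroup

variable {n : ℕ} {K : Type*} [Field K]

theorem linIncl_apply (f : V n K ≃ₗ[K] V n K) (x : V n K) : linIncl n K f x = f x := rfl

theorem v_zero_apply_zero : v n K 0 0 = 1 := by simp [v]

theorem v_zero_ne_zero : v n K 0 ≠ 0 := fun h => by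
  simpa [h] using v_zero_apply_zero (n := n) (K := K)

theorem v_zero_mem_alpha0 : v n K 0 ∈ alpha0 n K := Submodule.mem_span_singleton_self _

theorem mem_alpha0_iff {x : V n K} : x ∈ alpha0 n K ↔ ∃ a : K, a • v n K 0 = x :=
  Submodule.mem_span_singleton

theorem mem_hyperplane_iff {x : V n K} : x ∈ hyperplane n K ↔ x 0 = 0 := by
  constructor
  · intro h
    have : hyperplane n K ≤ LinearMap.ker (LinearMap.proj (R := K) (φ := fun _ => K) 0) := by
      refine Submodule.span_le.2 ?_
      rintro _ ⟨i, rfl⟩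
      simp [v]
    exact this h
  · intro h
    have : x = ∑ i : Fin n, x i.succ • v n K i.succ := by
      rw [pi_eq_sum_univ' x, Fin.sum_univ_succ, h, zero_smul, zero_add]
      simp [v, Pi.single_apply, Finset.sum_apply, Fin.succ_inj]
    rw [this]
    exact Submodule.sum_mem _ fun i _ => Submodule.smul_mem _ _ (Submodule.subset_span ⟨i, rfl⟩)

theorem linIncl_mem_SpecLin {f : V n K ≃ₗ[K] V n K} (hf : LinearEquiv.det f = 1) :
    linIncl n K f ∈ SpecLin n K :=
  ⟨f, hf, rfl⟩

theorem linIncl_mem_fix_alpha0 {H : Subgroup (Equiv.Perm (V n K))} {f : V n K ≃ₗ[K] V n K}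
    (hH : linIncl n K f ∈ H) (hf : f (v n K 0) = v n K 0) :
    linIncl n K f ∈ fix H (alpha0 n K) := by
  refine ⟨hH, (mem_fixingSubgroup_iff _).2 fun y hy => ?_⟩
  obtain ⟨a, rfl⟩ := mem_alpha0_iff.1 hy
  rw [Equiv.Perm.smul_def, linIncl_apply, map_smul, hf]

open scoped Pointwise in
theorem linIncl_mem_stab_hyperplane {f : V n K ≃ₗ[K] V n K} (hf : ∀ x, f x 0 = x 0) :
    linIncl n K f ∈ stab (GenLin n K) (hyperplane n K) := by
  refine ⟨⟨f, rfl⟩, ?_⟩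
  refine MulAction.mem_stabilizer_iff.2 ?_
  ext x
  rw [Set.mem_smul_set_iff_inv_smul_mem, SetLike.mem_coe, SetLike.mem_coe, mem_hyperplane_iff,
    mem_hyperplane_iff, ← hf (_ • x), ← linIncl_apply, Equiv.Perm.smul_def, apply_inv_apply]

/-- The group `M` contains the stabilizer of `v 0` in the special linear group. -/
theorem linIncl_mem_M {G : Subgroup (Equiv.Perm (V n K))} (hG : SpecLin n K ≤ G)
    {m : V n K ≃ₗ[K] V n K} (hdet : LinearEquiv.det m = 1) (hm : m (v n K 0) = v n K 0) :
    linIncl n K m ∈ M G := by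
  -- Here `f (m x)` is the change that `m` makes in coordinate `0`. Hence the transvection `t` along
  -- `v 0`, an element of `W`, absorbs this change, and `t⁻¹ * m` preserves coordinate `0`.
  let f : Module.Dual K (V n K) :=
    LinearMap.proj (R := K) (φ := fun _ => K) 0 ∘ₗ (LinearMap.id - m.symm.toLinearMap)
  have hf : ∀ x, f x = x 0 - m.symm x 0 := fun x => rfl
  have hf0 : f (v n K 0) = 0 := by
    rw [hf, (LinearEquiv.symm_apply_eq m).2 hm.symm, sub_self]
  let t := LinearEquiv.transvection hf0
  have ht : ∀ x, t x = x + f x • v n K 0 := LinearEquiv.transvection.apply hf0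
  have htdet : LinearEquiv.det t = 1 := LinearEquiv.transvection.det_eq_one hf0
  have htv : t (v n K 0) = v n K 0 := by rw [ht, hf0, zero_smul, add_zero]
  have htG := hG (linIncl_mem_SpecLin htdet)
  have hb : ∀ x, (t⁻¹ * m) x + f ((t⁻¹ * m) x) • v n K 0 = m x := fun x => by
    rw [← ht]
    exact t.apply_symm_apply (m x)
  have hb0 : (t⁻¹ * m) (v n K 0) = v n K 0 := by
    change t.symm (m (v n K 0)) = _
    rw [hm, LinearEquiv.symm_apply_eq, htv]
  have hbx : ∀ x, (t⁻¹ * m) x 0 = x 0 := by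
    intro x
    have h1 : f ((t⁻¹ * m) x) = m x 0 - x 0 := by
      have := congrArg f (hb x)
      rwa [map_add, map_smul, hf0, smul_zero, add_zero, hf (m x),
        LinearEquiv.symm_apply_apply] at this
    have h2 := congrFun (hb x) 0
    rw [Pi.add_apply, Pi.smul_apply, v_zero_apply_zero, h1, smul_eq_mul, mul_one] at h2
    linear_combination h2
  have hW : linIncl n K t ∈ W G := by
    refine ⟨⟨htG, fun x => ?_⟩, linIncl_mem_fix_alpha0 htG htv⟩
    rw [linIncl_apply, ht, add_sub_cancel_left]
    exact Submodule.smul_mem _ _ v_zero_mem_alpha0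
  have hS : linIncl n K (t⁻¹ * m) ∈ SLsmall n K :=
    ⟨⟨linIncl_mem_fix_alpha0 ⟨_, rfl⟩ hb0, linIncl_mem_stab_hyperplane hbx⟩,
      linIncl_mem_SpecLin (by rw [map_mul, map_inv, htdet, hdet, inv_one, one_mul])⟩
  have : linIncl n K m = linIncl n K t * linIncl n K (t⁻¹ * m) := by
    rw [← map_mul, mul_inv_cancel_left]
  rw [this]
  exact mul_mem (Subgroup.mem_sup_left hW) (Subgroup.mem_sup_right (Subgroup.mem_sup_right hS))

open scoped Pointwise in
theorem mem_stab_alpha0_iff {G : Subgroup (Equiv.Perm (V n K))} (hG : G ≤ GammaL n K)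
    {g : Equiv.Perm (V n K)} :
    g ∈ stab G (alpha0 n K) ↔ g ∈ G ∧ g (v n K 0) ∈ alpha0 n K := by
  refine and_congr_right fun hg => ?_
  refine MulAction.mem_stabilizer_iff.trans ?_
  constructor
  · intro h
    rw [← SetLike.mem_coe, ← h]
    exact Set.smul_mem_smul_set v_zero_mem_alpha0
  · intro h
    obtain ⟨hadd, σ, hσ⟩ := hG hg
    obtain ⟨a, ha⟩ := mem_alpha0_iff.1 h
    have h0 : g 0 = 0 := by simpa using hσ 0 0
    have ha0 : a ≠ 0 := by
      rintro rfl
      rw [zero_smul] at ha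
      exact v_zero_ne_zero (g.injective (ha.symm.trans h0.symm))
    ext x
    rw [Set.mem_smul_set_iff_inv_smul_mem, SetLike.mem_coe, SetLike.mem_coe, mem_alpha0_iff,
      mem_alpha0_iff]
    constructor
    · rintro ⟨c, hc⟩
      refine ⟨σ c * a, ?_⟩
      rw [← apply_inv_apply g x, ← Equiv.Perm.smul_def g⁻¹, ← hc, hσ, ← ha, smul_smul]
    · rintro ⟨c, rfl⟩
      refine ⟨σ.symm (c * a⁻¹), g.injective ?_⟩
      rw [hσ, Equiv.Perm.smul_def, apply_inv_apply, ← ha, RingEquiv.apply_symm_apply, smul_smul,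
        inv_mul_cancel_right₀ ha0]

/-- Semilinear conjugates of transvections are linear of determinant `1`. -/
theorem exists_conj_transvection_eq {g : Equiv.Perm (V n K)} (hg : g ∈ GammaL n K)
    {f : Module.Dual K (V n K)} {u : V n K} (hfu : f u = 0) :
    ∃ t : V n K ≃ₗ[K] V n K, LinearEquiv.det t = 1 ∧
      g⁻¹ * linIncl n K (LinearEquiv.transvection hfu) * g = linIncl n K t := by
  obtain ⟨hadd, σ, hσ⟩ := hg
  -- Composing with `σ.symm` cancels the twist of `g`, so this functional is linear.
  let f' : Module.Dual K (V n K) :=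
    { toFun := fun x => σ.symm (f (g x))
      map_add' := fun x y => by rw [hadd, map_add, map_add]
      map_smul' := fun a x => by
        rw [hσ, map_smul, smul_eq_mul, map_mul, RingEquiv.symm_apply_apply]
        rfl }
  have hf' : ∀ x, f' x = σ.symm (f (g x)) := fun x => rfl
  have h0 : f' (g⁻¹ u) = 0 := by rw [hf', apply_inv_apply, hfu, map_zero]
  refine ⟨LinearEquiv.transvection h0, LinearEquiv.transvection.det_eq_one h0,
    Equiv.ext fun x => g.injective ?_⟩
  rw [Equiv.Perm.mul_apply, Equiv.Perm.mul_apply, apply_inv_apply, linIncl_apply, linIncl_apply,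
    LinearEquiv.transvection.apply, LinearEquiv.transvection.apply, hadd, hσ, apply_inv_apply,
    hf', RingEquiv.apply_symm_apply]

theorem exists_transvection_apply_notMem_alpha0 (hn : 2 ≤ n) :
    ∃ (f : Module.Dual K (V n K)) (u : V n K) (h : f u = 0),
      LinearEquiv.transvection h (v n K 0) ∉ alpha0 n K := by
  have h01 : (0 : Fin (n + 1)) ≠ Fin.last n := by
    rw [Ne, Fin.ext_iff, Fin.val_zero, Fin.val_last]
    omega
  refine ⟨LinearMap.proj (R := K) (φ := fun _ => K) 0, v n K (Fin.last n), ?_, ?_⟩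
  · simp [v, h01]
  · rw [LinearEquiv.transvection.apply, mem_alpha0_iff]
    rintro ⟨a, ha⟩
    have := congrFun ha (Fin.last n)
    simp [v, h01.symm] at this

theorem e_eq_iff [Finite K] {L G : Subgroup (Equiv.Perm (V n K))} (hLG : L ≤ G) :
    e L = e G ↔ ∀ x ∈ G, ∃ l ∈ L, l⁻¹ * x ∈ GenLin n K := by
  rw [e, e, linPart, linPart, Subgroup.inf_relIndex_left, Subgroup.inf_relIndex_left,
    Subgroup.relIndex_eq_relIndex_iff _ hLG]

/-- `L` and `G` have the same index of linear elements and the same determinants if and only if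
`G = L · SL (n + 1, K)`. -/
theorem e_eq_and_detLin_eq_iff [Finite K] {L G : Subgroup (Equiv.Perm (V n K))} (hLG : L ≤ G) :
    e L = e G ∧ detLin L = detLin G ↔
      ∀ x ∈ G, ∃ l ∈ L, ∃ s : V n K ≃ₗ[K] V n K, LinearEquiv.det s = 1 ∧ x = l * linIncl n K s := by
  rw [e_eq_iff hLG]
  constructor
  · rintro ⟨he, hd⟩ x hx
    obtain ⟨l, hl, f, hf⟩ := he x hx
    have hfG : linIncl n K f ∈ G := hf ▸ G.mul_mem (G.inv_mem (hLG hl)) hx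
    have : LinearEquiv.det f ∈ detLin L := hd ▸ ⟨f, hfG, rfl⟩
    obtain ⟨f', hf', hdet⟩ := this
    refine ⟨l * linIncl n K f', L.mul_mem hl hf', f'⁻¹ * f, ?_, ?_⟩
    · rw [map_mul, map_inv, ← hdet]
      exact inv_mul_cancel _
    · rw [mul_assoc, ← map_mul, mul_inv_cancel_left, hf, mul_inv_cancel_left]
  · intro h
    refine ⟨fun x hx => ?_, le_antisymm ?_ ?_⟩
    · obtain ⟨l, hl, s, -, rfl⟩ := h x hx
      exact ⟨l, hl, s, by rw [inv_mul_cancel_left]⟩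
    · exact Subgroup.map_mono (Subgroup.comap_mono hLG)
    · rintro _ ⟨f, hf, rfl⟩
      obtain ⟨l, hl, s, hs, hfl⟩ := h _ hf
      refine ⟨f * s⁻¹, ?_, ?_⟩
      · change linIncl n K (f * s⁻¹) ∈ L
        rwa [map_mul, map_inv, hfl, mul_inv_cancel_right]
      · rw [map_mul, map_inv, hs, inv_one, mul_one]

theorem two_lt_finrank (hn : 2 ≤ n) : 2 < Module.finrank K (V n K) := by
  rw [Module.finrank_fin_fun]
  omega

theorem hasTwoByBlockTransitiveCosetAction_iff (hn : 2 ≤ n)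
    {L G : Subgroup (Equiv.Perm (V n K))} (hSG : SpecLin n K ≤ G) (hG : G ≤ GammaL n K)
    (hML : M G ≤ L) (hL : L ≤ stab G (alpha0 n K)) :
    BlockAction.HasTwoByBlockTransitiveCosetAction G L (stab G (alpha0 n K)) ↔
      ∀ x ∈ G, ∃ l ∈ L, ∃ s : V n K ≃ₗ[K] V n K, LinearEquiv.det s = 1 ∧ x = l * linIncl n K s := by
  rw [BlockAction.hasTwoByBlockTransitiveCosetAction_iff hL inf_le_left]
  have hLG : L ≤ G := hL.trans inf_le_left
  obtain ⟨f, u, hfu, hf⟩ := exists_transvection_apply_notMem_alpha0 (K := K) hn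
  set t := LinearEquiv.transvection hfu
  have ht : LinearEquiv.det t = 1 := LinearEquiv.transvection.det_eq_one hfu
  have htG : linIncl n K t ∈ G := hSG (linIncl_mem_SpecLin ht)
  have htH : linIncl n K t ∉ stab G (alpha0 n K) := fun h => hf ((mem_stab_alpha0_iff hG).1 h).2
  constructor
  · rintro ⟨-, h⟩
    have key : ∀ x ∈ G, x ∉ stab G (alpha0 n K) → ∃ l ∈ L, ∃ s : V n K ≃ₗ[K] V n K,
        LinearEquiv.det s = 1 ∧ x = l * linIncl n K s := by
      intro x hx hxH
      obtain ⟨a, ha, b, hb, rfl⟩ := h _ htG htH x hx hxH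
      obtain ⟨s, hs, hst⟩ := exists_conj_transvection_eq (hG (hLG hb)) hfu
      exact ⟨a * b, L.mul_mem ha hb, s, hs, by rw [← hst]; simp only [t]; group⟩
    intro x hx
    by_cases hxH : x ∈ stab G (alpha0 n K)
    -- For `x ∈ H`, the product `x t` leaves `H`, and `t` can be removed on the right inside `SL (n
    -- + 1, K)`.
    · obtain ⟨l, hl, s, hs, hxs⟩ := key (x * linIncl n K t) (G.mul_mem hx htG)
        fun h => htH ((Subgroup.mul_mem_cancel_left _ hxH).1 h)
      refine ⟨l, hl, s * t⁻¹, by rw [map_mul, map_inv, hs, ht, inv_one, mul_one], ?_⟩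
      rw [map_mul, ← mul_assoc, ← hxs, map_inv, mul_inv_cancel_right]
    · exact key x hx hxH
  · intro h
    refine ⟨⟨_, htG, htH⟩, fun x hx hxH y hy hyH => ?_⟩
    have hout : ∀ l ∈ L, ∀ s : V n K ≃ₗ[K] V n K, LinearEquiv.det s = 1 →
        l * linIncl n K s ∉ stab G (alpha0 n K) →
        s (v n K 0) ∉ Submodule.span K {v n K 0} := by
      intro l hl s hs hls hsv
      exact hls (mul_mem (hL hl)
        ((mem_stab_alpha0_iff hG).2 ⟨hSG (linIncl_mem_SpecLin hs), hsv⟩))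
    obtain ⟨l, hl, s, hs, rfl⟩ := h x hx
    obtain ⟨l', hl', s', hs', rfl⟩ := h y hy
    -- Since `m` takes `s (v 0)` to `s' (v 0)`, both `m` and `(m s)⁻¹ s'` fix `v 0` and so lie in
    -- `L`.
    obtain ⟨m, hm, hmv, hms⟩ := LinearEquiv.exists_det_eq_one_of_notMem_span (two_lt_finrank hn)
      (hout l' hl' s' hs' hyH) (hout l hl s hs hxH)
    have hmem : ∀ m : V n K ≃ₗ[K] V n K, LinearEquiv.det m = 1 → m (v n K 0) = v n K 0 →
        linIncl n K m ∈ L := fun m h1 h2 => hML (linIncl_mem_M hSG h1 h2)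
    refine ⟨l' * linIncl n K m * l⁻¹, mul_mem (mul_mem hl' (hmem m hm hmv)) (inv_mem hl),
      linIncl n K ((m * s)⁻¹ * s'), hmem _ ?_ ?_, ?_⟩
    · rw [map_mul, map_inv, map_mul, hm, hs, hs', mul_one, mul_one, inv_one]
    · change (m * s).symm (s' (v n K 0)) = _
      rw [LinearEquiv.symm_apply_eq]
      exact hms.symm
    · simp only [map_mul, map_inv]
      group

/-! ### Determinants of scalars and the index of `L` in `G(α₀)` -/

theorem linIncl_smulOfUnit_mem_Z (a : Kˣ) : linIncl n K (LinearEquiv.smulOfUnit a) ∈ Z n K :=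
  ⟨a, fun _ => rfl⟩

theorem det_smulOfUnit (a : Kˣ) :
    LinearEquiv.det (LinearEquiv.smulOfUnit a : V n K ≃ₗ[K] V n K) = a ^ (n + 1) := by
  ext
  rw [LinearEquiv.coe_det, Units.val_pow_eq_pow_val]
  have : ((LinearEquiv.smulOfUnit a : V n K ≃ₗ[K] V n K) : V n K →ₗ[K] V n K) =
      (a : K) • LinearMap.id := rfl
  rw [this, LinearMap.det_smul, LinearMap.det_id, mul_one, Module.finrank_fin_fun]

/-- The group of linear elements of `H` fixing `v 0`. -/
def fixLin (H : Subgroup (Equiv.Perm (V n K))) : Subgroup (V n K ≃ₗ[K] V n K) :=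
  H.comap (linIncl n K) ⊓ MulAction.stabilizer (V n K ≃ₗ[K] V n K) (v n K 0)

theorem mem_fixLin {H : Subgroup (Equiv.Perm (V n K))} {f : V n K ≃ₗ[K] V n K} :
    f ∈ fixLin H ↔ linIncl n K f ∈ H ∧ f (v n K 0) = v n K 0 := Iff.rfl

theorem exists_mul_smulOfUnit_inv_apply {f : V n K ≃ₗ[K] V n K}
    (hf : f (v n K 0) ∈ alpha0 n K) :
    ∃ a : Kˣ, (f * (LinearEquiv.smulOfUnit a)⁻¹ : V n K ≃ₗ[K] V n K) (v n K 0) = v n K 0 := by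
  obtain ⟨a, ha⟩ := mem_alpha0_iff.1 hf
  have ha0 : a ≠ 0 := by
    rintro rfl
    rw [zero_smul, eq_comm, LinearEquiv.map_eq_zero_iff] at ha
    exact v_zero_ne_zero ha
  refine ⟨Units.mk0 a ha0, ?_⟩
  change f (a⁻¹ • v n K 0) = _
  rw [map_smul, ← ha, inv_smul_smul₀ ha0]

/-- The special linear group is transitive on nonzero vectors, so `f (v 0)` can be moved back to `v
0` at no cost in determinant. -/
theorem map_det_fixLin (hn : 2 ≤ n) {G : Subgroup (Equiv.Perm (V n K))} (hSG : SpecLin n K ≤ G) :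
    (fixLin G).map LinearEquiv.det = detLin G := by
  refine le_antisymm (Subgroup.map_mono inf_le_left) ?_
  rintro _ ⟨f, hf, rfl⟩
  obtain ⟨s, hs, hsf⟩ := LinearEquiv.exists_det_eq_one_of_ne_zero (two_lt_finrank hn)
    (w := v n K 0) (w' := f (v n K 0)) v_zero_ne_zero
    (fun h => v_zero_ne_zero ((LinearEquiv.map_eq_zero_iff f).1 h))
  refine ⟨s * f, mem_fixLin.2 ⟨?_, hsf⟩, by rw [map_mul, hs, one_mul]⟩
  rw [map_mul]
  exact G.mul_mem (hSG (linIncl_mem_SpecLin hs)) hf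

/-- A linear element of `L` scales `v 0` by some `a`; dividing by the scalar `a ∈ Z ≤ L` makes it
fix `v 0` and changes the determinant by `a ^ (n + 1)`. -/
theorem map_det_fixLin_sup_zpowers {μ : Kˣ} (hμ : ∀ x : Kˣ, x ∈ Subgroup.zpowers μ)
    {G L : Subgroup (Equiv.Perm (V n K))} (hG : G ≤ GammaL n K) (hZL : Z n K ≤ L)
    (hL : L ≤ stab G (alpha0 n K)) :
    (fixLin L).map LinearEquiv.det ⊔ Subgroup.zpowers (μ ^ (n + 1)) = detLin L := by
  refine le_antisymm (sup_le (Subgroup.map_mono inf_le_left) ?_) ?_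
  · rw [Subgroup.zpowers_le, ← det_smulOfUnit]
    exact ⟨_, hZL (linIncl_smulOfUnit_mem_Z μ), rfl⟩
  · rintro _ ⟨f, hf, rfl⟩
    obtain ⟨a, ha⟩ := exists_mul_smulOfUnit_inv_apply
      ((mem_stab_alpha0_iff hG).1 (hL hf)).2
    have hd : LinearEquiv.det f =
        LinearEquiv.det (f * (LinearEquiv.smulOfUnit a)⁻¹) * a ^ (n + 1) := by
      rw [← det_smulOfUnit, map_mul, map_inv, inv_mul_cancel_right]
    rw [hd]
    refine Subgroup.mul_mem_sup ⟨_, mem_fixLin.2 ⟨?_, ha⟩, rfl⟩ ?_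
    · rw [map_mul, map_inv]
      exact L.mul_mem hf (L.inv_mem (hZL (linIncl_smulOfUnit_mem_Z a)))
    · obtain ⟨k, rfl⟩ := hμ a
      refine ⟨k, ?_⟩
      simp only [← zpow_natCast, ← zpow_mul, mul_comm]

/-- By `e L = e G` and `Z ≤ L`, each left coset of `L` in `G(α₀)` has a linear representative fixing
`v 0`. Whether such an element lies in `L` depends only on its determinant, because `L` contains the
stabilizer of `v 0` in the special linear group. -/
theorem relIndex_stab_alpha0 [Finite K] (hn : 2 ≤ n) {G L : Subgroup (Equiv.Perm (V n K))}
    (hSG : SpecLin n K ≤ G) (hG : G ≤ GammaL n K) (hML : M G ≤ L)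
    (hL : L ≤ stab G (alpha0 n K)) (he : e L = e G) :
    L.relIndex (stab G (alpha0 n K)) =
      ((fixLin L).map LinearEquiv.det).relIndex (detLin G) := by
  have hLG : L ≤ G := hL.trans inf_le_left
  have hZL : Z n K ≤ L := (le_sup_left.trans le_sup_right).trans hML
  have hle : (fixLin G).map (linIncl n K) ≤ stab G (alpha0 n K) := by
    rintro _ ⟨f, hf, rfl⟩
    refine (mem_stab_alpha0_iff hG).2 ⟨hf.1, ?_⟩
    rw [linIncl_apply, (mem_fixLin.1 hf).2]
    exact v_zero_mem_alpha0
  have h1 : L.relIndex ((fixLin G).map (linIncl n K)) = L.relIndex (stab G (alpha0 n K)) := by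
    rw [Subgroup.relIndex_eq_relIndex_iff _ hle]
    intro c hc
    -- Inverting `c` gives `f⁻¹ = c l`, which lies in the left coset `c L`.
    obtain ⟨l, hl, f, hf⟩ := (e_eq_iff hLG).1 he c⁻¹ (inv_mem hc.1)
    have hfH : linIncl n K f⁻¹ ∈ stab G (alpha0 n K) := by
      rw [map_inv, hf]
      exact inv_mem (mul_mem (inv_mem (hL hl)) (inv_mem hc))
    obtain ⟨a, ha⟩ := exists_mul_smulOfUnit_inv_apply (f := f⁻¹)
      ((mem_stab_alpha0_iff hG).1 hfH).2
    have hz := hZL (linIncl_smulOfUnit_mem_Z a)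
    refine ⟨_, ⟨_, mem_fixLin.2 ⟨?_, ha⟩, rfl⟩, ?_⟩
    · rw [map_mul, map_inv]
      exact mul_mem hfH.1 (inv_mem (hLG hz))
    · have : (linIncl n K (f⁻¹ * (LinearEquiv.smulOfUnit a)⁻¹))⁻¹ * c =
          linIncl n K (LinearEquiv.smulOfUnit a) * l⁻¹ := by
        rw [map_mul, map_inv, map_inv, hf]
        group
      rw [this]
      exact mul_mem hz (inv_mem hl)
  have h2 : (fixLin G) ⊓ (L.comap (linIncl n K)) =
      (fixLin G) ⊓ ((fixLin L).map LinearEquiv.det).comap LinearEquiv.det := by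
    ext f
    refine and_congr_right fun hf => ⟨fun h => ⟨f, ⟨h, hf.2⟩, rfl⟩, ?_⟩
    rintro ⟨f', hf', hdet⟩
    have hm : linIncl n K (f'⁻¹ * f) ∈ L := by
      refine hML (linIncl_mem_M hSG ?_ ?_)
      · rw [map_mul, map_inv, ← hdet]
        exact inv_mul_cancel _
      · change f'.symm (f (v n K 0)) = _
        rw [(mem_fixLin.1 hf).2, LinearEquiv.symm_apply_eq, (mem_fixLin.1 hf').2]
    rw [map_mul, map_inv] at hm
    exact (L.mul_mem_cancel_left (L.inv_mem hf'.1)).1 hm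
  rw [← h1, ← map_det_fixLin hn hSG, ← Subgroup.relIndex_comap, ← Subgroup.relIndex_comap,
    ← Subgroup.inf_relIndex_left, h2, Subgroup.inf_relIndex_left]

theorem card_PdetLin (μ : Kˣ) (G : Subgroup (Equiv.Perm (V n K))) :
    Nat.card (PdetLin μ G) = (Subgroup.zpowers (μ ^ (n + 1))).relIndex (detLin G) := by
  rw [PdetLin, ← Subgroup.relIndex_ker, QuotientGroup.ker_mk']

end SemilinearGroup

open SemilinearGroup in
theorem mainTheorem7 (n : ℕ) (hn : 2 ≤ n) (K : Type*) [Field K] [Finite K]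
    (μ : Kˣ) (hμ : ∀ x : Kˣ, x ∈ Subgroup.zpowers μ)
    (G : Subgroup (Equiv.Perm (SemilinearGroup.V n K)))
    (hG : SemilinearGroup.Z n K ⊔ SemilinearGroup.SpecLin n K ≤ G)
    (hG' : G ≤ SemilinearGroup.GammaL n K)
    (L : Subgroup (Equiv.Perm (SemilinearGroup.V n K)))
    (hML : SemilinearGroup.M G ≤ L)
    (hL : L ≤ SemilinearGroup.stab G (SemilinearGroup.alpha0 n K)) :
    List.TFAE [
      BlockAction.HasTwoByBlockTransitiveCosetAction G L
        (SemilinearGroup.stab G (SemilinearGroup.alpha0 n K)),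
      SemilinearGroup.e L = SemilinearGroup.e G ∧
        SemilinearGroup.detLin L = SemilinearGroup.detLin G,
      SemilinearGroup.e L = SemilinearGroup.e G ∧
        Nat.Coprime (L.relIndex (SemilinearGroup.stab G (SemilinearGroup.alpha0 n K)))
          (Nat.card (SemilinearGroup.PdetLin μ G))] := by
  have hSG : SpecLin n K ≤ G := le_sup_right.trans hG
  have hLG : L ≤ G := hL.trans inf_le_left
  have hZL : Z n K ≤ L := (le_sup_left.trans le_sup_right).trans hML
  tfae_have 1 ↔ 2 := by
    rw [hasTwoByBlockTransitiveCosetAction_iff hn hSG hG' hML hL, e_eq_and_detLin_eq_iff hLG]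
  tfae_have 2 ↔ 3 := by
    refine and_congr_right fun he => ?_
    have hsup := map_det_fixLin_sup_zpowers hμ hG' hZL hL
    have hle : detLin L ≤ detLin G := Subgroup.map_mono (Subgroup.comap_mono hLG)
    rw [relIndex_stab_alpha0 hn hSG hG' hML hL he, card_PdetLin,
      ← Subgroup.sup_eq_iff_coprime_relIndex (le_sup_left.trans (hsup.le.trans hle))
        (le_sup_right.trans (hsup.le.trans hle)), hsup]
  tfae_finish
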